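/- Let $X$ be a standard Borel space, let $\mathcal B(X)$ be the $\sigma$-algebra of its Borel sets, and let $\mathcal J\subseteq\mathcal B(X)$ be a $\sigma$-ideal (that is, $\emptyset\in\mathcal J$, and $\mathcal J$ is closed under Borel subsets and countable unions) that contains at least one uncountable Borel set. Let $G(X,\mathcal J)$ be the group, under composition, of all Borel bijections $f:X\to X$ such that for every $B\in\mathcal B(X)$ one has $f^{-1}(B)\in\mathcal J$ if and only if $B\in\mathcal J$. Let $I(X,\mathcal J)=\{f\in G(X,\mathcal J):\{x\in X: f(x)\neq x\}\in\mathcal J\}$, which is a normal subgroup, let $\mathrm{Aut}(X,\mathcal J)=G(X,\mathcal J)/I(X,\mathcal J)$, and let $\varphi_{\mathcal J}:G(X,\mathcal J)\to\mathrm{Aut}(X,\mathcal J)$ be the quotient homomorphism. Then for every subgroup $G\leq\mathrm{Aut}(X,\mathcal J)$ of cardinality at most $\aleph_1$ there is a group homomorphism $h:G\to G(X,\mathcal J)$ such that $\varphi_{\mathcal J}\circ h=\mathrm{id}_G$, i.e. $\varphi_{\mathcal J}(h(T))=T$ for all $T\in G$. -/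

import Mathlib

/-- A `σ`-ideal in the `σ`-algebra of Borel (i.e. measurable) sets of `X`: a family of Borel sets
containing `∅` and closed under Borel subsets and countable unions. (`X` itself may belong to
it.) -/
structure BorelSigmaIdeal (X : Type*) [MeasurableSpace X] where
  /-- The members of the `σ`-ideal. -/
  sets : Set (Set X)
  measurableSet_of_mem : ∀ {B : Set X}, B ∈ sets → MeasurableSet B
  empty_mem : ∅ ∈ sets
  mem_of_subset : ∀ {A B : Set X}, B ∈ sets → MeasurableSet A → A ⊆ B → A ∈ sets
  iUnion_mem : ∀ {B : ℕ → Set X}, (∀ n, B n ∈ sets) → (⋃ n, B n) ∈ sets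

theorem BorelSigmaIdeal.union_mem {X : Type*} [MeasurableSpace X] (J : BorelSigmaIdeal X)
    {A B : Set X} (hA : A ∈ J.sets) (hB : B ∈ J.sets) : A ∪ B ∈ J.sets := by
  rw [Set.union_eq_iUnion]
  have h : (⋃ b : Bool, cond b A B) = ⋃ n : ℕ, (if n = 0 then A else B) := by
    ext x
    simp only [Set.mem_iUnion]
    constructor
    · rintro ⟨b, hb⟩
      cases b
      · exact ⟨1, by simpa using hb⟩
      · exact ⟨0, by simpa using hb⟩
    · rintro ⟨n, hn⟩
      by_cases h0 : n = 0
      · exact ⟨true, by simpa [h0] using hn⟩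
      · exact ⟨false, by simpa [h0] using hn⟩
  rw [h]
  refine J.iUnion_mem fun n => ?_
  by_cases h0 : n = 0
  · simpa [h0] using hA
  · simpa [h0] using hB

/-- The inverse of a Borel bijection of a standard Borel space is Borel. -/
theorem measurable_perm_symm {X : Type*} [MeasurableSpace X] [StandardBorelSpace X]
    {f : Equiv.Perm X} (hf : Measurable f) : Measurable f.symm := by
  intro s hs
  rw [← Equiv.image_eq_preimage_symm]
  exact (hf.measurableEmbedding f.injective).measurableSet_image' hs

/-- The group `G(X, J)` of Borel bijections `f : X → X` such that, for every Borel set `B`,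
`f⁻¹(B) ∈ J` if and only if `B ∈ J`. The group operation is composition. -/
def borelPreservingGroup {X : Type*} [MeasurableSpace X] [StandardBorelSpace X]
    (J : BorelSigmaIdeal X) : Subgroup (Equiv.Perm X) where
  carrier := {f | Measurable f ∧ ∀ B : Set X, MeasurableSet B → (f ⁻¹' B ∈ J.sets ↔ B ∈ J.sets)}
  one_mem' := ⟨measurable_id, fun _ _ => Iff.rfl⟩
  mul_mem' := by
    rintro f g ⟨hf, hfJ⟩ ⟨hg, hgJ⟩
    exact ⟨hf.comp hg, fun B hB => (hgJ (f ⁻¹' B) (hf hB)).trans (hfJ B hB)⟩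
  inv_mem' := by
    rintro f ⟨hf, hfJ⟩
    refine ⟨measurable_perm_symm hf, fun B hB => ?_⟩
    have hB' : MeasurableSet (f.symm ⁻¹' B) := measurable_perm_symm hf hB
    have h := hfJ (f.symm ⁻¹' B) hB'
    have h2 : f ⁻¹' (f.symm ⁻¹' B) = B := by ext x; simp
    rw [h2] at h
    exact h.symm

theorem measurableSet_perm_ne {X : Type*} [MeasurableSpace X] [StandardBorelSpace X]
    {f : Equiv.Perm X} (hf : Measurable f) : MeasurableSet {x | f x ≠ x} :=
  (measurableSet_eq_fun hf measurable_id).compl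

/-- The subgroup `I(X, J)` of those `f ∈ G(X, J)` with `{x | f x ≠ x} ∈ J`. -/
def trivialModIdeal {X : Type*} [MeasurableSpace X] [StandardBorelSpace X]
    (J : BorelSigmaIdeal X) : Subgroup (borelPreservingGroup J) where
  carrier := {f | {x : X | (f : Equiv.Perm X) x ≠ x} ∈ J.sets}
  one_mem' := by simpa using J.empty_mem
  mul_mem' := by
    intro f g hf hg
    refine J.mem_of_subset (J.union_mem hf hg) (measurableSet_perm_ne (f * g).2.1) ?_
    intro x hx
    by_contra hcon
    simp only [Set.mem_union, Set.mem_ofPred_eq, not_or, not_not] at hcon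
    refine hx ?_
    simp [hcon.1, hcon.2]
  inv_mem' := by
    intro f hf
    refine J.mem_of_subset hf (measurableSet_perm_ne f⁻¹.2.1) ?_
    intro x hx hfx
    refine hx ?_
    change (f : Equiv.Perm X).symm x = x
    rw [Equiv.symm_apply_eq]
    exact hfx.symm

instance trivialModIdeal_normal {X : Type*} [MeasurableSpace X] [StandardBorelSpace X]
    (J : BorelSigmaIdeal X) : (trivialModIdeal J).Normal where
  conj_mem := by
    intro f hf g
    have h := ((g⁻¹).2.2 _ (measurableSet_perm_ne f.2.1)).2 hf
    refine J.mem_of_subset h (measurableSet_perm_ne (g * f * g⁻¹).2.1) ?_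
    intro x hx hfx
    refine hx ?_
    change (g : Equiv.Perm X) ((f : Equiv.Perm X) ((g : Equiv.Perm X).symm x)) = x
    have h1 : (f : Equiv.Perm X) ((g : Equiv.Perm X).symm x) = (g : Equiv.Perm X).symm x := hfx
    rw [h1, Equiv.apply_symm_apply]

/-- The quotient group `Aut(X, J) = G(X, J) / I(X, J)`. -/
abbrev AutModIdeal {X : Type*} [MeasurableSpace X] [StandardBorelSpace X]
    (J : BorelSigmaIdeal X) : Type _ :=
  borelPreservingGroup J ⧸ trivialModIdeal J

/-- The canonical homomorphism `φ_J : G(X, J) → Aut(X, J)`. -/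
def quotientModIdeal {X : Type*} [MeasurableSpace X] [StandardBorelSpace X]
    (J : BorelSigmaIdeal X) : borelPreservingGroup J →* AutModIdeal J :=
  QuotientGroup.mk' (trivialModIdeal J)

-- The group is the union of an increasing chain, indexed by ω₁, of countable subgroups, and
-- coherent lifts are built along it. Representatives of a countable group obey its relations off an
-- invariant set of the ideal (`exists_invariant_mem_forall_mul`), and inside that set the action
-- can be changed freely. The difficulty is coherence: a lift on `H` already acts there, and a Borel
-- action of `H` need not extend to a larger group `H'`.
--
-- The remedy is a reserve, embedded in `X` with range in `J`, that carries a partial action `a`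
-- fixed in advance (`exists_universal_partial_action`). Every lift must follow `a` wherever the
-- laws for its own subgroup hold. Where the laws for `H'` hold, `a` dictates the extension. The
-- rest `S` of the exceptional set contains, by universality of `a`, a copy of the shift of `H'`
-- restricted to `H`; conversely `S` embeds into that shift by an orbit map. Equivariant
-- Cantor–Bernstein then identifies `S`, over `H`, with a space on which all of `H'` acts
-- (`IsLiftOn.exists_extension`). Before each extension the earlier lifts are united
-- (`IsLiftOn.exists_union`).

universe u

/-! ### Generalities on groups, actions and transfinite recursion -/

theorem Subgroup.countable_closure {G : Type*} [Group G] {s : Set G} (hs : s.Countable) :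
    Countable (Subgroup.closure s) := by
  have : Countable s := hs.to_subtype
  have : Countable (FreeGroup s) := Quotient.countable
  have h : (FreeGroup.lift ((↑) : s → G)).range = Subgroup.closure s := by
    rw [FreeGroup.range_lift_eq_closure, Subtype.range_coe]
  rw [← h]
  exact (Set.countable_range (FreeGroup.lift ((↑) : s → G))).to_subtype

/-- The homomorphism into the permutation group defined by a group action. -/
def permHomOfAction {K X : Type*} [Group K] (α : K → X → X) (h1 : ∀ x, α 1 x = x)
    (hmul : ∀ g h x, α (g * h) x = α g (α h x)) : K →* Equiv.Perm X :=
  letI : MulAction K X := { smul := α, one_smul := h1, mul_smul := hmul }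
  MulAction.toPermHom K X

@[simp] theorem permHomOfAction_apply {K X : Type*} [Group K] (α : K → X → X)
    (h1 : ∀ x, α 1 x = x) (hmul : ∀ g h x, α (g * h) x = α g (α h x)) (g : K) (x : X) :
    permHomOfAction α h1 hmul g x = α g x := rfl

theorem hom_inv_apply_apply {K X : Type*} [Group K] (ρ : K →* Equiv.Perm X) (k : K) (x : X) :
    ρ k⁻¹ (ρ k x) = x := by
  simp

/-- A coherent family along a well-order exists as soon as every coherent family on a proper
initial segment can be extended by one step. -/
theorem exists_coherent_family {I S : Type*} [LinearOrder I] [WellFoundedLT I] [Nonempty S]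
    (good : I → S → Prop) (agree : I → S → S → Prop)
    (step : ∀ (i : I) (f : I → S), (∀ j < i, good j (f j)) →
      (∀ j k, j < k → k < i → agree j (f j) (f k)) →
      ∃ s, good i s ∧ ∀ j < i, agree j (f j) s) :
    ∃ f : I → S, (∀ i, good i (f i)) ∧ ∀ i j, i < j → agree i (f i) (f j) := by
  classical
  -- The arbitrary value only makes the recursion total; the induction below shows that it is never
  -- taken.
  let next : ∀ i : I, (∀ j, j < i → S) → S := fun i prev =>
    if h : ∃ s, good i s ∧ ∀ (j : I) (hj : j < i), agree j (prev j hj) s then h.choose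
    else Classical.arbitrary S
  let f : I → S := (wellFounded_lt (α := I)).fix next
  have hf : ∀ i, f i = next i fun j _ => f j := fun i => WellFounded.fix_eq _ _ _
  have key : ∀ i, good i (f i) ∧ ∀ j < i, agree j (f j) (f i) := by
    intro i
    induction i using WellFoundedLT.induction with
    | ind i ih =>
      have h : ∃ s, good i s ∧ ∀ (j : I) (hj : j < i), agree j (f j) s :=
        step i f (fun j hj => (ih j hj).1) fun j k hjk hk => (ih k hk).2 j hjk
      have h2 : f i = h.choose := by rw [hf]; exact dif_pos h
      rw [h2]
      exact h.choose_spec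
  exact ⟨f, fun i => (key i).1, fun i j hij => (key j).2 i hij⟩

/-! ### Equivariant Cantor–Bernstein and gluing of actions -/

/-- An equivariant Borel Cantor–Bernstein theorem. -/
theorem exists_equivariant_embedding_range_eq {K X V : Type*} [Group K]
    [MeasurableSpace X] [StandardBorelSpace X] [MeasurableSpace V] [StandardBorelSpace V]
    (α : K →* Equiv.Perm X) (β : K →* Equiv.Perm V)
    {f : X → V} (hf : Measurable f) (hfi : f.Injective) (hfe : ∀ k x, f (α k x) = β k (f x))
    {g : V → X} (hg : Measurable g) (hgi : g.Injective) (hge : ∀ k v, g (β k v) = α k (g v))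
    {S : Set X} (hS : MeasurableSet S) (hSα : ∀ k, ∀ x ∈ S, α k x ∈ S) (hgS : ∀ v, g v ∈ S) :
    ∃ θ : V → X, Measurable θ ∧ θ.Injective ∧ Set.range θ = S ∧
      ∀ k v, θ (β k v) = α k (θ v) := by
  classical
  rcases isEmpty_or_nonempty X with hX | ⟨⟨x₀⟩⟩
  · exact ⟨g, hg, hgi, by ext x; exact hX.elim x, hge⟩
  have hfE := hf.measurableEmbedding hfi
  have hgE := hg.measurableEmbedding hgi
  let D : Set X := S \ Set.range g
  -- The forward orbit of `D` under `g ∘ f`. The bijection is `f⁻¹` on `f '' A` and `g` elsewhere;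
  -- it is equivariant because `A` is invariant.
  let A : Set X := ⋃ n : ℕ, ((fun x => g (f x))^[n]) '' D
  have hD : MeasurableSet D := hS.diff hgE.measurableSet_range
  have hA : MeasurableSet A := by
    refine MeasurableSet.iUnion fun n => ?_
    refine ((Measurable.iterate (hg.comp hf) n).measurableEmbedding ?_).measurableSet_image' hD
    exact (hgi.comp hfi).iterate n
  have hDA : D ⊆ A := fun x hx => Set.mem_iUnion.2 ⟨0, x, hx, rfl⟩
  have hAstep : ∀ x ∈ A, g (f x) ∈ A := by
    intro x hx
    obtain ⟨n, y, hy, rfl⟩ := Set.mem_iUnion.1 hx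
    exact Set.mem_iUnion.2 ⟨n + 1, y, hy, Function.iterate_succ_apply' _ _ _⟩
  have hAcases : ∀ x ∈ A, x ∈ D ∨ ∃ y ∈ A, x = g (f y) := by
    intro x hx
    obtain ⟨n, y, hy, rfl⟩ := Set.mem_iUnion.1 hx
    cases n with
    | zero => exact Or.inl hy
    | succ n =>
      exact Or.inr ⟨_, Set.mem_iUnion.2 ⟨n, y, hy, rfl⟩, Function.iterate_succ_apply' _ _ _⟩
  have hAS : A ⊆ S := by
    intro x hx
    rcases hAcases x hx with h | ⟨y, -, rfl⟩
    · exact h.1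
    · exact hgS _
  have hDα : ∀ k, ∀ x ∈ D, α k x ∈ D := by
    rintro k x ⟨hx, hxg⟩
    refine ⟨hSα k x hx, ?_⟩
    rintro ⟨v, hv⟩
    refine hxg ⟨β k⁻¹ v, ?_⟩
    rw [hge, hv, hom_inv_apply_apply]
  have hAα : ∀ k, ∀ x ∈ A, α k x ∈ A := by
    intro k x hx
    obtain ⟨n, y, hy, rfl⟩ := Set.mem_iUnion.1 hx
    refine Set.mem_iUnion.2 ⟨n, α k y, hDα k y hy, ?_⟩
    have hc : Function.Commute (α k) (fun x => g (f x)) := fun x => by simp only [hfe, hge]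
    exact ((hc.iterate_right n) y).symm
  have hgA : ∀ v, g v ∈ A → v ∈ f '' A := by
    intro v hv
    rcases hAcases _ hv with h | ⟨y, hy, h⟩
    · exact absurd ⟨v, rfl⟩ h.2
    · exact ⟨y, hy, (hgi h).symm⟩
  let θ : V → X := fun v => if v ∈ f '' A then Function.extend f id (fun _ => x₀) v else g v
  have hθ1 : ∀ x ∈ A, θ (f x) = x := by
    intro x hx
    change (if f x ∈ f '' A then _ else _) = _
    rw [if_pos ⟨x, hx, rfl⟩, hfi.extend_apply]; rfl
  have hθ2 : ∀ v, v ∉ f '' A → θ v = g v := fun v hv => if_neg hv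
  have hθA : ∀ v, v ∈ f '' A → θ v ∈ A := by
    rintro _ ⟨x, hx, rfl⟩; rwa [hθ1 x hx]
  have hθA' : ∀ v, v ∉ f '' A → θ v ∉ A := by
    intro v hv h
    rw [hθ2 v hv] at h
    exact hv (hgA v h)
  refine ⟨θ, ?_, ?_, ?_, ?_⟩
  · exact Measurable.ite (hfE.measurableSet_image' hA)
      (hfE.measurable_extend measurable_id measurable_const) hg
  · intro v w hvw
    by_cases hv : v ∈ f '' A
    · have hw : w ∈ f '' A := by
        by_contra hw
        exact hθA' w hw (hvw ▸ hθA v hv)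
      obtain ⟨x, hx, rfl⟩ := hv
      obtain ⟨y, hy, rfl⟩ := hw
      rw [hθ1 x hx, hθ1 y hy] at hvw
      rw [hvw]
    · have hw : w ∉ f '' A := fun hw => hθA' v hv (hvw ▸ hθA w hw)
      rw [hθ2 v hv, hθ2 w hw] at hvw
      exact hgi hvw
  · ext x
    constructor
    · rintro ⟨v, rfl⟩
      by_cases hv : v ∈ f '' A
      · exact hAS (hθA v hv)
      · rw [hθ2 v hv]; exact hgS v
    · intro hx
      by_cases hxA : x ∈ A
      · exact ⟨f x, hθ1 x hxA⟩
      · have : x ∈ Set.range g := by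
          by_contra h
          exact hxA (hDA ⟨hx, h⟩)
        obtain ⟨v, rfl⟩ := this
        refine ⟨v, hθ2 v ?_⟩
        rintro ⟨y, hy, rfl⟩
        exact hxA (hAstep y hy)
  · intro k v
    by_cases hv : v ∈ f '' A
    · obtain ⟨x, hx, rfl⟩ := hv
      rw [← hfe, hθ1 _ (hAα k x hx), hθ1 x hx]
    · have hkv : β k v ∉ f '' A := by
        rintro ⟨y, hy, hyv⟩
        refine hv ⟨α k⁻¹ y, hAα _ y hy, ?_⟩
        rw [hfe, hyv, hom_inv_apply_apply]
      rw [hθ2 v hv, hθ2 _ hkv, hge]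

/-- Replacing the trivial part of a Borel action by a given Borel action. -/
theorem exists_glued_action {K X P : Type*} [Group K] [MeasurableSpace X] [StandardBorelSpace X]
    [MeasurableSpace P] [StandardBorelSpace P]
    (ρ : K →* Equiv.Perm X) (hρ : ∀ k, Measurable (ρ k))
    (p : K →* Equiv.Perm P) (hp : ∀ k, Measurable (p k))
    {θ : P → X} (hθ : Measurable θ) (hθi : θ.Injective) (hρθ : ∀ k v, ρ k (θ v) = θ v) :
    ∃ ρ' : K →* Equiv.Perm X, (∀ k, Measurable (ρ' k)) ∧ (∀ k v, ρ' k (θ v) = θ (p k v)) ∧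
      ∀ k, ∀ x ∉ Set.range θ, ρ' k x = ρ k x := by
  have hθE := hθ.measurableEmbedding hθi
  let α : K → X → X := fun k => Function.extend θ (fun v => θ (p k v)) (ρ k)
  have hα1 : ∀ k v, α k (θ v) = θ (p k v) := fun k v => hθi.extend_apply _ _ _
  have hα2 : ∀ k, ∀ x ∉ Set.range θ, α k x = ρ k x :=
    fun k x hx => Function.extend_apply' _ _ _ hx
  -- The range of `θ` is fixed pointwise by `ρ`, so its complement is invariant.
  have hout : ∀ k, ∀ x ∉ Set.range θ, ρ k x ∉ Set.range θ := by
    rintro k x hx ⟨v, hv⟩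
    refine hx ⟨v, (ρ k).injective ?_⟩
    rw [hρθ, hv]
  refine ⟨permHomOfAction α ?_ ?_, fun k => ?_, fun k v => ?_, fun k x hx => ?_⟩
  · intro x
    by_cases hx : x ∈ Set.range θ
    · obtain ⟨v, rfl⟩ := hx
      rw [hα1, map_one, Equiv.Perm.one_apply]
    · rw [hα2 _ x hx, map_one, Equiv.Perm.one_apply]
  · intro g h x
    by_cases hx : x ∈ Set.range θ
    · obtain ⟨v, rfl⟩ := hx
      rw [hα1, hα1, hα1, map_mul, Equiv.Perm.mul_apply]
    · rw [hα2 _ x hx, hα2 _ x hx, hα2 _ _ (hout h x hx), map_mul, Equiv.Perm.mul_apply]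
  · exact hθE.measurable_extend (hθ.comp (hp k)) (hρ k)
  · rw [permHomOfAction_apply, hα1]
  · rw [permHomOfAction_apply, hα2 k x hx]

/-! ### The reserve and its universal partial action -/

/-- The reserve: a point consists of a sequence of pairs `(name, index map)` and of a sequence of
bits, whose indices the maps permute. -/
abbrev ReserveSpace : Type := (ℕ → (ℕ → Bool) × (ℕ → ℕ)) × (ℕ → Bool)

/-- The set of points at which the maps `a g`, `g ∈ H`, obey the laws of an action of `H`. -/
def actionDomain {Γ W : Type*} [Group Γ] (a : Γ → W → W) (H : Subgroup Γ) : Set W :=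
  {w | a 1 w = w ∧ ∀ g ∈ H, ∀ h ∈ H, a g (a h w) = a (g * h) w}

section actionDomain

variable {Γ W : Type*} [Group Γ] {a : Γ → W → W} {H H' : Subgroup Γ}

theorem actionDomain_anti (h : H ≤ H') : actionDomain a H' ⊆ actionDomain a H :=
  fun _ hw => ⟨hw.1, fun g hg k hk => hw.2 g (h hg) k (h hk)⟩

theorem apply_mem_actionDomain {g : Γ} (hg : g ∈ H) {w : W} (hw : w ∈ actionDomain a H) :
    a g w ∈ actionDomain a H := by
  refine ⟨?_, fun k hk l hl => ?_⟩
  · rw [hw.2 1 H.one_mem g hg, one_mul]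
  · rw [hw.2 l hl g hg, hw.2 k hk _ (H.mul_mem hl hg), hw.2 _ (H.mul_mem hk hl) g hg, mul_assoc]

theorem measurableSet_actionDomain [MeasurableSpace W] [StandardBorelSpace W] [Countable H]
    (ha : ∀ g, Measurable (a g)) : MeasurableSet (actionDomain a H) := by
  have : actionDomain a H = {w | a 1 w = w} ∩
      ⋂ (g : H) (h : H), {w | a g (a h w) = a (g * h) w} := by
    ext w
    simp [actionDomain]
  rw [this]
  exact (measurableSet_eq_fun (ha 1) measurable_id).inter <| MeasurableSet.iInter fun g =>
    MeasurableSet.iInter fun h => measurableSet_eq_fun ((ha g).comp (ha h)) (ha _)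

/-- The action of `H` on the points where the laws of an action hold. -/
def actionDomainHom (a : Γ → W → W) (H : Subgroup Γ) : H →* Equiv.Perm (actionDomain a H) :=
  permHomOfAction (fun g w => ⟨a g w, apply_mem_actionDomain g.2 w.2⟩)
    (fun w => Subtype.ext w.2.1)
    (fun g h w => Subtype.ext (w.2.2 g g.2 h h.2).symm)

end actionDomain

/-- A group of size at most the continuum acts partially on the reserve in such a way that every
Borel action of a countable subgroup `H` embeds into the part where the action of `H` is defined but
that of no element outside `H` is. -/
theorem exists_universal_partial_action {Γ : Type*} [Group Γ] {c : Γ → ℕ → Bool}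
    (hc : c.Injective) :
    ∃ a : Γ → ReserveSpace → ReserveSpace, (∀ g, Measurable (a g)) ∧
      ∀ (H : Subgroup Γ) [Countable H] {Z : Type*} [MeasurableSpace Z] [StandardBorelSpace Z]
        (σ : H →* Equiv.Perm Z), (∀ h, Measurable (σ h)) →
        ∃ ι : Z → ReserveSpace, Measurable ι ∧ ι.Injective ∧ (∀ h z, ι (σ h z) = a h (ι z)) ∧
          ∀ (H' : Subgroup Γ), ¬ H' ≤ H → ∀ z, ι z ∉ actionDomain a H' := by
  classical
  -- `a g` looks up the name `c g` and pulls the bits back along the index map stored there; an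
  -- unlisted name erases all bits.
  let a : Γ → ReserveSpace → ReserveSpace := fun g w =>
    (w.1, fun m => decide (∃ n, (w.1 n).1 = c g ∧ w.2 ((w.1 n).2 m) = true))
  have ha : ∀ g w m, (a g w).2 m = true ↔
      ∃ n, (w.1 n).1 = c g ∧ w.2 ((w.1 n).2 m) = true := fun g w m => by simp [a]
  refine ⟨a, fun g => ?_, ?_⟩
  · refine measurable_fst.prodMk (measurable_pi_lambda _ fun m => ?_)
    refine measurable_to_bool ?_
    have : (fun w : ReserveSpace => decide (∃ n, (w.1 n).1 = c g ∧ w.2 ((w.1 n).2 m) = true)) ⁻¹'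
        {true} = ⋃ n : ℕ, ⋃ k : ℕ, {w | (w.1 n).1 = c g} ∩ {w | (w.1 n).2 m = k} ∩
          {w | w.2 k = true} := by
      ext w
      simp
    rw [this]
    refine MeasurableSet.iUnion fun n => MeasurableSet.iUnion fun k => ?_
    refine ((measurableSet_eq_fun ?_ measurable_const).inter
      (measurableSet_eq_fun ?_ measurable_const)).inter
      (measurableSet_eq_fun ?_ measurable_const) <;> fun_prop
  · intro H _ Z _ _ σ hσ
    obtain ⟨ψ, hψ, hψi⟩ :=
      MeasurableSpace.measurable_injection_nat_bool_of_countablySeparated Z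
    obtain ⟨e⟩ : Nonempty (ℕ ≃ H × ℕ) := nonempty_equiv_of_countable
    let x : ℕ → (ℕ → Bool) × (ℕ → ℕ) := fun n =>
      (c (e n).1, fun m => e.symm ((e m).1 * (e n).1, (e m).2))
    -- Bit `0` is a marker that is always true; the later bits code the orbit of `z`, on which `σ`
    -- acts by right translation of indices.
    let bit : H → ℕ → Z → Bool := fun h j z => j.casesOn true fun i => ψ (σ h z) i
    have hbit : ∀ h j, Measurable (bit h j) := by
      intro h j
      cases j with
      | zero => exact measurable_const
      | succ j => exact (measurable_pi_apply j).comp (hψ.comp (hσ h))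
    let ι : Z → ReserveSpace := fun z => (x, fun m => bit (e m).1 (e m).2 z)
    have hout : ∀ g ∉ H, ∀ y : ℕ → Bool, a g (x, y) = (x, fun _ => false) := by
      intro g hg y
      refine Prod.ext rfl (funext fun m => decide_eq_false ?_)
      rintro ⟨n, hn, -⟩
      exact hg (hc hn ▸ (e n).1.2)
    refine ⟨ι, ?_, ?_, ?_, ?_⟩
    · exact measurable_const.prodMk (measurable_pi_lambda _ fun m => hbit _ _)
    · intro z z' h
      refine hψi (funext fun i => ?_)
      have := congrFun (congrArg Prod.snd h) (e.symm (1, i + 1))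
      simpa [ι, bit] using this
    · intro h z
      refine Prod.ext rfl (funext fun m => ?_)
      rw [Bool.eq_iff_iff]
      refine Iff.trans ?_ (ha h (ι z) m).symm
      change bit (e m).1 (e m).2 (σ h z) = true ↔ ∃ n, c (e n).1 = c h ∧
        bit (e (e.symm ((e m).1 * (e n).1, (e m).2))).1
          (e (e.symm ((e m).1 * (e n).1, (e m).2))).2 z = true
      have hb : ∀ k j, bit k j (σ h z) = bit (k * h) j z := by
        intro k j
        cases j with
        | zero => rfl
        | succ j => simp [bit]
      simp only [Equiv.apply_symm_apply, hb]
      constructor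
      · intro hm
        exact ⟨e.symm (h, 0), by simp, by simpa using hm⟩
      · rintro ⟨n, hn, hm⟩
        rwa [← Subtype.ext (hc hn)]
    · intro H' hH z hz
      obtain ⟨g, hg', hg⟩ := Set.not_subset.1 hH
      -- The laws would let `g⁻¹` undo `g`, but `g` has no name in `x` and erases the marker.
      have h2 := hz.2 g⁻¹ (H'.inv_mem hg') g hg'
      rw [inv_mul_cancel, hz.1] at h2
      have h3 : a g⁻¹ (a g (ι z)) = (x, fun _ => false) := by
        rw [hout g hg, hout _ (fun h => hg (inv_inv g ▸ H.inv_mem h))]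
      have := congrFun (congrArg Prod.snd (h3.symm.trans h2)) (e.symm (1, 0))
      simp [ι, bit] at this

/-! ### Representatives and lifts modulo the ideal -/

theorem BorelSigmaIdeal.iUnion_mem_of_countable {X ι : Type*} [MeasurableSpace X]
    (J : BorelSigmaIdeal X) [Countable ι] {B : ι → Set X} (hB : ∀ i, B i ∈ J.sets) :
    (⋃ i, B i) ∈ J.sets := by
  rcases isEmpty_or_nonempty ι with h | h
  · simpa using J.empty_mem
  · obtain ⟨e, he⟩ := exists_surjective_nat ι
    rw [← he.iUnion_comp]
    exact J.iUnion_mem fun n => hB (e n)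

section

variable {X : Type*} [MeasurableSpace X] [StandardBorelSpace X] {J : BorelSigmaIdeal X}

/-- A Borel bijection which agrees with an element of `G(X, J)` off a set in `J` belongs to
`G(X, J)`, and it has the same class modulo `I(X, J)`. -/
theorem exists_mem_quotientModIdeal_eq {f : Equiv.Perm X} (hf : Measurable f)
    (q : borelPreservingGroup J) {N : Set X} (hN : N ∈ J.sets)
    (hfq : ∀ x ∉ N, f x = (q : Equiv.Perm X) x) :
    ∃ h : f ∈ borelPreservingGroup J, quotientModIdeal J ⟨f, h⟩ = quotientModIdeal J q := by
  have hfJ : ∀ B : Set X, MeasurableSet B → (f ⁻¹' B ∈ J.sets ↔ B ∈ J.sets) := by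
    intro B hB
    rw [← q.2.2 B hB]
    constructor
    · intro h
      refine J.mem_of_subset (J.union_mem h hN) (q.2.1 hB) fun x hx => ?_
      by_cases hxN : x ∈ N
      · exact Or.inr hxN
      · exact Or.inl (by rwa [Set.mem_preimage, hfq x hxN])
    · intro h
      refine J.mem_of_subset (J.union_mem h hN) (hf hB) fun x hx => ?_
      by_cases hxN : x ∈ N
      · exact Or.inr hxN
      · exact Or.inl (by rwa [Set.mem_preimage, ← hfq x hxN])
  refine ⟨⟨hf, hfJ⟩, ?_⟩
  let f' : borelPreservingGroup J := ⟨f, hf, hfJ⟩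
  refine QuotientGroup.eq.2 (J.mem_of_subset hN (measurableSet_perm_ne (f'⁻¹ * q).2.1) ?_)
  intro x hx
  by_contra hxN
  refine hx ?_
  change f.symm ((q : Equiv.Perm X) x) = x
  rw [← hfq x hxN, Equiv.symm_apply_apply]

/-- Representatives of the elements of a countable group satisfy its relations off an invariant set
of the ideal. -/
theorem exists_invariant_mem_forall_mul {Γ : Type*} [Group Γ] (π : Γ →* AutModIdeal J)
    (H : Subgroup Γ) [Countable H] {q : Γ → borelPreservingGroup J}
    (hq : ∀ g ∈ H, quotientModIdeal J (q g) = π g) {N₀ : Set X} (hN₀ : N₀ ∈ J.sets) :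
    ∃ N ∈ J.sets, N₀ ⊆ N ∧ (∀ g ∈ H, ∀ x, (q g : Equiv.Perm X) x ∈ N ↔ x ∈ N) ∧
      ∀ g ∈ H, ∀ h ∈ H, ∀ x ∉ N,
        (q (g * h) : Equiv.Perm X) x = (q g : Equiv.Perm X) ((q h : Equiv.Perm X) x) := by
  let bad : Γ → Γ → Set X := fun g h =>
    {x | (((q (g * h))⁻¹ * (q g * q h) : borelPreservingGroup J) : Equiv.Perm X) x ≠ x}
  have hbad : ∀ g ∈ H, ∀ h ∈ H, bad g h ∈ J.sets := by
    intro g hg h hh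
    have : quotientModIdeal J (q (g * h)) = quotientModIdeal J (q g * q h) := by
      rw [map_mul, hq _ (H.mul_mem hg hh), hq g hg, hq h hh, map_mul]
    exact QuotientGroup.eq.1 this
  let B : Set X := N₀ ∪ ⋃ p : H × H, bad p.1 p.2
  have hB : B ∈ J.sets :=
    J.union_mem hN₀ (J.iUnion_mem_of_countable fun p => hbad _ p.1.2 _ p.2.2)
  -- The representatives need not form a group; saturating `B` under the countable group they
  -- generate keeps it in `J`.
  let D : Subgroup (borelPreservingGroup J) := Subgroup.closure (q '' H)
  have hqD : ∀ g ∈ H, q g ∈ D := fun g hg => Subgroup.subset_closure ⟨g, hg, rfl⟩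
  have : Countable D :=
    Subgroup.countable_closure (Set.Countable.image (Set.to_countable (H : Set Γ)) q)
  let N : Set X := ⋃ d : D, ((d : borelPreservingGroup J) : Equiv.Perm X) ⁻¹' B
  have hBN : B ⊆ N := fun x hx => Set.mem_iUnion.2 ⟨1, hx⟩
  refine ⟨N, J.iUnion_mem_of_countable fun d => ?_, fun x hx => hBN (Or.inl hx), ?_, ?_⟩
  · exact (d.1.2.2 B (J.measurableSet_of_mem hB)).2 hB
  · intro g hg x
    constructor
    · intro h
      obtain ⟨d, hd⟩ := Set.mem_iUnion.1 h
      refine Set.mem_iUnion.2 ⟨d * ⟨q g, hqD g hg⟩, ?_⟩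
      exact hd
    · intro h
      obtain ⟨d, hd⟩ := Set.mem_iUnion.1 h
      refine Set.mem_iUnion.2 ⟨d * ⟨q g, hqD g hg⟩⁻¹, ?_⟩
      have : (d : Equiv.Perm X) ((q g : Equiv.Perm X).symm ((q g : Equiv.Perm X) x)) ∈ B := by
        rwa [Equiv.symm_apply_apply]
      exact this
  · intro g hg h hh x hx
    have : x ∉ bad g h := fun hx' =>
      hx (hBN (Or.inr (Set.mem_iUnion.2 ⟨(⟨g, hg⟩, ⟨h, hh⟩), hx'⟩)))
    have h2 : (q (g * h) : Equiv.Perm X).symm ((q g : Equiv.Perm X) ((q h : Equiv.Perm X) x)) = x :=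
      not_not.1 this
    exact ((Equiv.symm_apply_eq _).1 h2).symm

/-- A lift on the subgroup `H` of a homomorphism into `Aut(X, J)` which acts by a prescribed partial
action on the range of `ε`. -/
structure IsLiftOn {Γ W : Type*} [Group Γ] (π : Γ →* AutModIdeal J) (a : Γ → W → W) (ε : W → X)
    (H : Subgroup Γ) (f : Γ → borelPreservingGroup J) : Prop where
  map_mul : ∀ g ∈ H, ∀ h ∈ H, f (g * h) = f g * f h
  quotient_eq : ∀ g ∈ H, quotientModIdeal J (f g) = π g
  apply_eq : ∀ g ∈ H, ∀ w ∈ actionDomain a H, (f g : Equiv.Perm X) (ε w) = ε (a g w)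

theorem IsLiftOn.map_one {Γ W : Type*} [Group Γ] {π : Γ →* AutModIdeal J} {a : Γ → W → W}
    {ε : W → X} {H : Subgroup Γ} {f : Γ → borelPreservingGroup J} (hf : IsLiftOn π a ε H f) :
    f 1 = 1 := by
  simpa using hf.map_mul 1 H.one_mem 1 H.one_mem

end

/-! ### Extending a lift by one step -/

/-- The shift action of a group on sequences of bits indexed by it. -/
def shiftHom (K : Type*) [Group K] : K →* Equiv.Perm (K → ℕ → Bool) :=
  permHomOfAction (fun g v k => v (k * g)) (fun v => by simp) (fun g h v => by simp [mul_assoc])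

theorem measurable_shiftHom {K : Type*} [Group K] (g : K) : Measurable (shiftHom K g) :=
  measurable_pi_lambda _ fun k => measurable_pi_apply (k * g)

/-- A lift on a countable subgroup extends to every larger countable subgroup, if the shift action
of the larger subgroup embeds into the part of the reserve which the extension may use. -/
theorem IsLiftOn.exists_extension {X Γ W : Type*} [MeasurableSpace X] [StandardBorelSpace X]
    {J : BorelSigmaIdeal X} [Group Γ] [MeasurableSpace W] [StandardBorelSpace W]
    {π : Γ →* AutModIdeal J} {a : Γ → W → W} (ha : ∀ g, Measurable (a g)) {ε : W → X}
    (hε : Measurable ε) (hεi : ε.Injective) (hεJ : Set.range ε ∈ J.sets)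
    {H H' : Subgroup Γ} [Countable H'] (hHH' : H ≤ H')
    (hι : ∃ ι : (H' → ℕ → Bool) → W, Measurable ι ∧ ι.Injective ∧
      (∀ h : H, ∀ v, ι (shiftHom H' (Subgroup.inclusion hHH' h) v) = a h (ι v)) ∧
      (∀ v, ι v ∉ actionDomain a H') ∧ ∀ v, ι v ∈ actionDomain a H)
    {f : Γ → borelPreservingGroup J} (hf : IsLiftOn π a ε H f) :
    ∃ f', IsLiftOn π a ε H' f' ∧ ∀ g ∈ H, f g = f' g := by
  classical
  obtain ⟨ι, hιm, hιi, hιe, hι', hιH⟩ := hι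
  -- Keeping `f` on `H` makes the new lift agree with the old one off `N`.
  let q : Γ → borelPreservingGroup J := fun g =>
    if g ∈ H then f g else (QuotientGroup.mk'_surjective (trivialModIdeal J) (π g)).choose
  have hqf : ∀ g ∈ H, q g = f g := fun g hg => if_pos hg
  have hq : ∀ g, quotientModIdeal J (q g) = π g := by
    intro g
    by_cases hg : g ∈ H
    · rw [hqf g hg, hf.quotient_eq g hg]
    · simp only [q, if_neg hg]
      exact (QuotientGroup.mk'_surjective (trivialModIdeal J) (π g)).choose_spec
  obtain ⟨N, hNJ, hεN, hNq, hNmul⟩ :=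
    exists_invariant_mem_forall_mul π H' (fun g _ => hq g) hεJ
  have hN := J.measurableSet_of_mem hNJ
  let R := actionDomain a H'
  have hR : MeasurableSet R := measurableSet_actionDomain ha
  have : StandardBorelSpace R := hR.standardBorel
  let k : H' →* Equiv.Perm X := permHomOfAction
    (fun g x => if x ∈ N then x else (q g : Equiv.Perm X) x)
    (fun x => by
      split_ifs with hx
      · rfl
      · refine (q 1 : Equiv.Perm X).injective ?_
        have := hNmul 1 H'.one_mem 1 H'.one_mem x hx
        rw [mul_one] at this
        exact this.symm)
    (fun g h x => by
      by_cases hx : x ∈ N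
      · simp only [if_pos hx]
      · have hx' : (q h : Equiv.Perm X) x ∉ N := fun hx' => hx ((hNq h h.2 x).1 hx')
        simp only [if_neg hx, if_neg hx']
        exact hNmul g g.2 h h.2 x hx)
  have hkm : ∀ g, Measurable (k g) := fun g => Measurable.ite hN measurable_id (q g).2.1
  have hkN : ∀ g, ∀ x ∈ N, k g x = x := fun g x hx => if_pos hx
  have hkq : ∀ g : H', ∀ x ∉ N, k g x = (q g : Equiv.Perm X) x := fun g x hx => if_neg hx
  obtain ⟨ρ, hρm, hρR, hρk⟩ := exists_glued_action k hkm (actionDomainHom a H')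
    (fun g => ((ha g).comp measurable_subtype_coe).subtype_mk)
    (θ := fun w : R => ε w) (hε.comp measurable_subtype_coe)
    (hεi.comp Subtype.val_injective) (fun g w => hkN g _ (hεN ⟨w, rfl⟩))
  let S : Set X := N \ Set.range fun w : R => ε w
  have hS : MeasurableSet S := hN.diff ((hε.comp measurable_subtype_coe).measurableEmbedding
    (hεi.comp Subtype.val_injective)).measurableSet_range
  let α : H →* Equiv.Perm X := MonoidHom.mk' (fun g => (f g : Equiv.Perm X)) fun g h => by
    rw [Subgroup.coe_mul, hf.map_mul g g.2 h h.2, Subgroup.coe_mul]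
  have hα : ∀ g : H, ∀ x, α g x = (f g : Equiv.Perm X) x := fun _ _ => rfl
  have hαR : ∀ g : H, ∀ w ∈ R, α g (ε w) = ε (a g w) := fun g w hw =>
    hf.apply_eq g g.2 w (actionDomain_anti hHH' hw)
  have hαS : ∀ g, ∀ x ∈ S, α g x ∈ S := by
    rintro g x ⟨hxN, hxR⟩
    refine ⟨?_, ?_⟩
    · rw [hα, ← hqf g g.2]
      exact (hNq g (hHH' g.2) x).2 hxN
    · rintro ⟨w, hw⟩
      refine hxR ⟨⟨a (g⁻¹ : H) w, apply_mem_actionDomain (hHH' (g⁻¹ : H).2) w.2⟩, ?_⟩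
      change ε (a (g⁻¹ : H) w) = x
      rw [← hαR _ _ w.2, show ε w = α g x from hw, hom_inv_apply_apply]
  obtain ⟨ψ, hψ, hψi⟩ := MeasurableSpace.measurable_injection_nat_bool_of_countablySeparated X
  -- The orbit map, padded by zeros outside `H`. Right translation by `H` preserves both `H` and its
  -- complement, so `F` is `H`-equivariant.
  let F : X → H' → ℕ → Bool := fun x g =>
    if (g : Γ) ∈ H then ψ ((f g : Equiv.Perm X) x) else fun _ => false
  have hFm : Measurable F := by
    refine measurable_pi_lambda _ fun g => ?_
    by_cases hg : (g : Γ) ∈ H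
    · simp only [F, if_pos hg]
      exact hψ.comp (f g).2.1
    · simp only [F, if_neg hg]
      exact measurable_const
  have hFi : F.Injective := by
    intro x y hxy
    have := congrFun hxy 1
    simp only [F, OneMemClass.coe_one, H.one_mem, if_true, hf.map_one] at this
    exact hψi this
  have hFe : ∀ (g : H) x, F (α g x) = (shiftHom H').comp (Subgroup.inclusion hHH') g (F x) := by
    intro g x
    funext l
    change (if (l : Γ) ∈ H then ψ ((f l : Equiv.Perm X) ((f g : Equiv.Perm X) x)) else _) =
      if (l : Γ) * g ∈ H then ψ ((f ((l : Γ) * g) : Equiv.Perm X) x) else _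
    by_cases hl : (l : Γ) ∈ H
    · rw [if_pos hl, if_pos (H.mul_mem hl g.2), hf.map_mul l hl g g.2]
      rfl
    · rw [if_neg hl, if_neg fun h => hl ((H.mul_mem_cancel_right g.2).1 h)]
  -- The opposite embedding `ε ∘ ι` lands in `S` because `ι` avoids `actionDomain a H'`, and is
  -- equivariant because `ι` stays in `actionDomain a H`, where `f` follows `a`.
  obtain ⟨θ, hθm, hθi, hθS, hθe⟩ := exists_equivariant_embedding_range_eq α
    ((shiftHom H').comp (Subgroup.inclusion hHH')) hFm hFi hFe
    (hε.comp hιm) (hεi.comp hιi)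
    (fun g v => by
      change ε (ι (shiftHom H' (Subgroup.inclusion hHH' g) v)) = (f g : Equiv.Perm X) (ε (ι v))
      rw [hιe, hf.apply_eq g g.2 _ (hιH v)]) hS hαS
    (fun v => ⟨hεN ⟨ι v, rfl⟩, by
      rintro ⟨w, hw⟩
      exact hι' v (hεi hw ▸ w.2)⟩)
  have hθS' : ∀ v, θ v ∈ S := fun v => hθS ▸ ⟨v, rfl⟩
  obtain ⟨τ, hτm, hτθ, hτρ⟩ := exists_glued_action ρ hρm (shiftHom H') measurable_shiftHom
    hθm hθi (fun g v => by rw [hρk g _ (hθS' v).2, hkN g _ (hθS' v).1])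
  rw [hθS] at hτρ
  have hτN : ∀ g : H', ∀ x ∉ N, τ g x = (q g : Equiv.Perm X) x := by
    intro g x hx
    have hxR : x ∉ Set.range fun w : R => ε w := by
      rintro ⟨w, rfl⟩
      exact hx (hεN ⟨w, rfl⟩)
    rw [hτρ g x fun h => hx h.1, hρk g x hxR, hkq g x hx]
  have hτR : ∀ g : H', ∀ w ∈ R, τ g (ε w) = ε (a g w) := by
    intro g w hw
    rw [hτρ g _ fun h => h.2 ⟨⟨w, hw⟩, rfl⟩]
    exact hρR g ⟨w, hw⟩
  have hτJ : ∀ g, ∃ h : τ g ∈ borelPreservingGroup J,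
      quotientModIdeal J ⟨τ g, h⟩ = quotientModIdeal J (q g) := fun g =>
    exists_mem_quotientModIdeal_eq (hτm g) (q g) hNJ (hτN g)
  let f' : Γ → borelPreservingGroup J := fun g =>
    if hg : g ∈ H' then ⟨τ ⟨g, hg⟩, (hτJ ⟨g, hg⟩).1⟩ else 1
  have hf' : ∀ g (hg : g ∈ H'), f' g = ⟨τ ⟨g, hg⟩, (hτJ ⟨g, hg⟩).1⟩ := fun g hg => dif_pos hg
  refine ⟨f', ⟨?_, ?_, ?_⟩, ?_⟩
  · intro g hg h hh
    rw [hf' g hg, hf' h hh, hf' _ (H'.mul_mem hg hh)]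
    exact Subtype.ext (τ.map_mul ⟨g, hg⟩ ⟨h, hh⟩)
  · intro g hg
    rw [hf' g hg, (hτJ ⟨g, hg⟩).2, hq]
  · intro g hg w hw
    rw [hf' g hg]
    exact hτR ⟨g, hg⟩ w hw
  · intro g hg
    rw [hf' g (hHH' hg)]
    refine Subtype.ext (Equiv.ext fun x => ?_)
    change (f g : Equiv.Perm X) x = τ ⟨g, hHH' hg⟩ x
    by_cases hxN : x ∈ N
    · by_cases hxR : x ∈ Set.range fun w : R => ε w
      · obtain ⟨w, rfl⟩ := hxR
        rw [hτR _ w w.2]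
        exact hαR ⟨g, hg⟩ w w.2
      · obtain ⟨v, rfl⟩ : x ∈ Set.range θ := hθS ▸ ⟨hxN, hxR⟩
        rw [hτθ]
        exact (hθe ⟨g, hg⟩ v).symm
    · rw [hτN _ x hxN, hqf g hg]

/-! ### Construction along ω₁ -/

/-- A set of size at most `ℵ₁` has a rank function into `ω₁` with countable sublevel sets. -/
theorem exists_rank_countable_le {Γ : Type u} (hΓ : Cardinal.mk Γ ≤ Cardinal.aleph 1) :
    ∃ ν : Γ → (Cardinal.aleph.{u} 1).ord.ToType, ∀ i, {g | ν g ≤ i}.Countable := by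
  rw [← Cardinal.mk_ord_toType (Cardinal.aleph 1)] at hΓ
  obtain ⟨ν⟩ := hΓ
  refine ⟨ν, fun i => ?_⟩
  have h1 : (Set.Iio i).Countable := by
    have := Cardinal.mk_Iio_lt i (by simp)
    rw [Cardinal.mk_ord_toType, Cardinal.lt_aleph_one_iff] at this
    exact Cardinal.le_aleph0_iff_set_countable.1 this
  have h2 : (Set.Iic i).Countable := by
    rw [← Set.Iio_insert]
    exact h1.insert i
  exact h2.preimage ν.injective

theorem exists_injective_cantor {Γ : Type*} (hΓ : Cardinal.mk Γ ≤ Cardinal.aleph 1) :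
    ∃ c : Γ → ℕ → Bool, c.Injective := by
  have h : Cardinal.lift.{0} (Cardinal.mk Γ) ≤ Cardinal.lift (Cardinal.mk (ℕ → Bool)) := by
    simpa using hΓ.trans Cardinal.aleph_one_le_continuum
  obtain ⟨c⟩ := Cardinal.lift_mk_le'.1 h
  exact ⟨c, c.injective⟩

theorem not_countable_reserveSpace : ¬ Countable ReserveSpace := by
  intro h
  have hmk : Cardinal.mk (ℕ → Bool) = Cardinal.continuum := by simp
  have : Countable (ℕ → Bool) := (Prod.mk_right_injective (β := ℕ → Bool)
    (fun _ : ℕ => ((fun _ : ℕ => false), (id : ℕ → ℕ)))).countable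
  have h2 := Cardinal.mk_le_aleph0_iff.2 this
  rw [hmk] at h2
  exact absurd h2 (not_le.2 Cardinal.aleph0_lt_continuum)

/-- Uncountable standard Borel spaces are isomorphic; this is where an uncountable member of the
ideal is needed. -/
theorem exists_embedding_range_mem {X : Type*} [MeasurableSpace X] [StandardBorelSpace X]
    (J : BorelSigmaIdeal X) (hJ : ∃ B ∈ J.sets, ¬ B.Countable) :
    ∃ ε : ReserveSpace → X, Measurable ε ∧ ε.Injective ∧ Set.range ε ∈ J.sets := by
  obtain ⟨B, hB, hBc⟩ := hJ
  have : StandardBorelSpace B := (J.measurableSet_of_mem hB).standardBorel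
  let e : ReserveSpace ≃ᵐ B := PolishSpace.measurableEquivOfNotCountable
    not_countable_reserveSpace hBc
  refine ⟨fun w => e w, measurable_subtype_coe.comp e.measurable,
    Subtype.val_injective.comp e.injective, ?_⟩
  have : (Set.range fun w => (e w : X)) = B := by
    rw [show (fun w => (e w : X)) = Subtype.val ∘ e from rfl, e.surjective.range_comp,
      Subtype.range_coe]
  rwa [this]

/-- Lifts on a chain of subgroups combine to a lift on its union. -/
theorem IsLiftOn.exists_union {X Γ W I : Type*} [MeasurableSpace X] [StandardBorelSpace X]
    {J : BorelSigmaIdeal X} [Group Γ] [LinearOrder I]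
    {π : Γ →* AutModIdeal J} {a : Γ → W → W} {ε : W → X} {s : Set I}
    {K : I → Subgroup Γ} (hK : Monotone K) {f : I → Γ → borelPreservingGroup J}
    (hf : ∀ j ∈ s, IsLiftOn π a ε (K j) (f j))
    (hff : ∀ j ∈ s, ∀ k ∈ s, j < k → ∀ g ∈ K j, f j g = f k g)
    {H : Subgroup Γ} (hKH : ∀ j ∈ s, K j ≤ H) (hH : ∀ g ∈ H, g = 1 ∨ ∃ j ∈ s, g ∈ K j) :
    ∃ f', IsLiftOn π a ε H f' ∧ ∀ j ∈ s, ∀ g ∈ K j, f j g = f' g := by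
  classical
  let f' : Γ → borelPreservingGroup J := fun g =>
    if h : ∃ j ∈ s, g ∈ K j then f h.choose g else 1
  have hf' : ∀ j ∈ s, ∀ g ∈ K j, f j g = f' g := by
    intro j hj g hg
    have h : ∃ j ∈ s, g ∈ K j := ⟨j, hj, hg⟩
    rw [show f' g = f h.choose g from dif_pos h]
    obtain ⟨hk, hgk⟩ := h.choose_spec
    rcases lt_trichotomy j h.choose with hlt | heq | hlt
    · exact hff j hj _ hk hlt g hg
    · rw [← heq]
    · exact (hff _ hk j hj hlt g hgk).symm
  -- If `s` is empty, the default value `1` serves as the lift on the trivial subgroup.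
  have h1 : f' 1 = 1 := by
    by_cases h : ∃ j, j ∈ s
    · obtain ⟨j, hj⟩ := h
      rw [← hf' j hj 1 (K j).one_mem, (hf j hj).map_one]
    · exact dif_neg fun ⟨j, hj, _⟩ => h ⟨j, hj⟩
  refine ⟨f', ⟨?_, ?_, ?_⟩, hf'⟩
  · intro g hg h hh
    rcases hH g hg with rfl | ⟨j, hj, hgj⟩
    · rw [one_mul, h1, one_mul]
    rcases hH h hh with rfl | ⟨k, hk, hhk⟩
    · rw [mul_one, h1, mul_one]
    obtain ⟨m, hm, hgm, hhm⟩ : ∃ m ∈ s, g ∈ K m ∧ h ∈ K m := by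
      rcases le_total j k with hle | hle
      · exact ⟨k, hk, hK hle hgj, hhk⟩
      · exact ⟨j, hj, hgj, hK hle hhk⟩
    rw [← hf' m hm g hgm, ← hf' m hm h hhm, ← hf' m hm _ ((K m).mul_mem hgm hhm),
      (hf m hm).map_mul g hgm h hhm]
  · intro g hg
    rcases hH g hg with rfl | ⟨j, hj, hgj⟩
    · rw [h1, _root_.map_one, _root_.map_one]
    · rw [← hf' j hj g hgj, (hf j hj).quotient_eq g hgj]
  · intro g hg w hw
    rcases hH g hg with rfl | ⟨j, hj, hgj⟩
    · rw [h1, hw.1]; rfl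
    · rw [← hf' j hj g hgj, (hf j hj).apply_eq g hgj w (actionDomain_anti (hKH j hj) hw)]

/-- Every homomorphism into `Aut(X, J)` from a group of size at most `ℵ₁` lifts to `G(X, J)`. -/
theorem exists_lift_of_card_le_aleph_one {X Γ : Type*} [MeasurableSpace X] [StandardBorelSpace X]
    (J : BorelSigmaIdeal X) (hJ : ∃ B ∈ J.sets, ¬ B.Countable) [Group Γ]
    (hΓ : Cardinal.mk Γ ≤ Cardinal.aleph 1) (π : Γ →* AutModIdeal J) :
    ∃ h : Γ →* borelPreservingGroup J, (quotientModIdeal J).comp h = π := by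
  obtain ⟨ν, hνc⟩ := exists_rank_countable_le hΓ
  obtain ⟨c, hc⟩ := exists_injective_cantor hΓ
  obtain ⟨a, ha, huniv⟩ := exists_universal_partial_action hc
  obtain ⟨ε, hε, hεi, hεJ⟩ := exists_embedding_range_mem J hJ
  let K : (Cardinal.aleph 1).ord.ToType → Subgroup Γ := fun i => Subgroup.closure {g | ν g ≤ i}
  have hK : Monotone K := fun i j hij => Subgroup.closure_mono fun g hg => le_trans hg hij
  have hKc : ∀ i, Countable (K i) := fun i => Subgroup.countable_closure (hνc i)
  obtain ⟨f, hf, hff⟩ := exists_coherent_family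
    (fun i f => IsLiftOn π a ε (K i) f) (fun i f f' => ∀ g ∈ K i, f g = f' g) (by
      intro i f hf hff
      let H : Subgroup Γ := Subgroup.closure {g | ν g < i}
      have hKH : ∀ j < i, K j ≤ H := fun j hj =>
        Subgroup.closure_mono fun g hg => lt_of_le_of_lt hg hj
      have hHK : H ≤ K i := Subgroup.closure_mono fun g (hg : ν g < i) => hg.le
      have hH : ∀ g ∈ H, g = 1 ∨ ∃ j ∈ Set.Iio i, g ∈ K j := by
        intro g hg
        induction hg using Subgroup.closure_induction with
        | mem g hg => exact Or.inr ⟨ν g, hg, Subgroup.subset_closure (le_refl (ν g))⟩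
        | one => exact Or.inl rfl
        | inv g _ ih =>
          rcases ih with rfl | ⟨j, hj, hg⟩
          · exact Or.inl inv_one
          · exact Or.inr ⟨j, hj, (K j).inv_mem hg⟩
        | mul g h _ _ ihg ihh =>
          rcases ihg with rfl | ⟨j, hj, hg⟩
          · rwa [one_mul]
          rcases ihh with rfl | ⟨k, hk, hh⟩
          · exact Or.inr ⟨j, hj, by rwa [mul_one]⟩
          rcases le_total j k with hle | hle
          · exact Or.inr ⟨k, hk, (K k).mul_mem (hK hle hg) hh⟩
          · exact Or.inr ⟨j, hj, (K j).mul_mem hg (hK hle hh)⟩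
      obtain ⟨f₀, hf₀, hff₀⟩ := IsLiftOn.exists_union (s := Set.Iio i) hK hf
        (fun j _ k hk hjk => hff j k hjk hk) hKH hH
      suffices h : ∃ f', IsLiftOn π a ε (K i) f' ∧ ∀ g ∈ H, f₀ g = f' g by
        obtain ⟨f', hf', h⟩ := h
        exact ⟨f', hf', fun j hj g hg => (hff₀ j hj g hg).trans (h g (hKH j hj hg))⟩
      -- Universality yields points outside the domain of `K i` only if `K i` is strictly larger
      -- than `H`.
      by_cases hle : K i ≤ H
      · rw [le_antisymm hle hHK]
        exact ⟨f₀, hf₀, fun _ _ => rfl⟩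
      have := hKc i
      have : Countable H := (Subgroup.inclusion_injective hHK).countable
      obtain ⟨ι, hιm, hιi, hιe, hι'⟩ := huniv H ((shiftHom (K i)).comp (Subgroup.inclusion hHK))
        fun h => measurable_shiftHom _
      refine hf₀.exists_extension ha hε hεi hεJ hHK
        ⟨ι, hιm, hιi, hιe, hι' _ hle, fun v => ⟨?_, fun g hg h hh => ?_⟩⟩
      · rw [← Subgroup.coe_one H, ← hιe, map_one, Equiv.Perm.one_apply]
      · have h1 := hιe ⟨h, hh⟩ v
        have h2 := hιe ⟨g, hg⟩ (((shiftHom (K i)).comp (Subgroup.inclusion hHK)) ⟨h, hh⟩ v)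
        have h3 := hιe (⟨g, hg⟩ * ⟨h, hh⟩) v
        rw [map_mul, Equiv.Perm.mul_apply, h2, h1] at h3
        exact h3)
  have hmem : ∀ g i, ν g ≤ i → g ∈ K i := fun g i hg => Subgroup.subset_closure hg
  have hle : ∀ g i, ν g ≤ i → f (ν g) g = f i g := by
    intro g i hg
    rcases hg.eq_or_lt with h | h
    · rw [← h]
    · exact hff _ _ h g (hmem g _ le_rfl)
  -- By coherence, `f (ν g) g` may be computed at any later stage, so a product is checked at one
  -- common stage.
  refine ⟨MonoidHom.mk' (fun g => f (ν g) g) fun g h => ?_, MonoidHom.ext fun g => ?_⟩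
  · let m := max (ν (g * h)) (max (ν g) (ν h))
    have hg : ν g ≤ m := (le_max_left _ _).trans (le_max_right _ _)
    have hh : ν h ≤ m := (le_max_right _ _).trans (le_max_right _ _)
    rw [hle (g * h) m (le_max_left _ _), hle g m hg, hle h m hh,
      (hf m).map_mul g (hmem g m hg) h (hmem h m hh)]
  · exact (hf (ν g)).quotient_eq g (hmem g _ le_rfl)

theorem theorem4 {X : Type*} [MeasurableSpace X] [StandardBorelSpace X]
    (J : BorelSigmaIdeal X) (hJ : ∃ B ∈ J.sets, ¬ B.Countable)
    (G : Subgroup (AutModIdeal J)) (hG : Cardinal.mk G ≤ Cardinal.aleph 1) :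
    ∃ h : G →* borelPreservingGroup J, (quotientModIdeal J).comp h = G.subtype :=
  exists_lift_of_card_le_aleph_one J hJ hG G.subtype
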